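/- Let $T>0$, let $\mathsf R=\begin{pmatrix}0&-1&0\\1&0&0\\0&0&-1\end{pmatrix}$, so that $\mathbb Z_4\cong\{I,\mathsf R,\mathsf R^2,\mathsf R^3\}$, and let $\Gamma=\{x\in\mathbb R^3:\mathsf R^kx=x\text{ for some }k\in\{1,2,3\}\}$ be the collision set. Consider a central body of mass $m_0\ge 0$ fixed at the origin and four satellites of unit mass with positions $\mathsf R^k u(t)$, $k=0,1,2,3$, where $u:\mathbb R\to\mathbb R^3$ is $T$-periodic. Let $H^1_T$ be the space of $T$-periodic loops $u:\mathbb R\to\mathbb R^3$ of class $H^1$ (continuous representatives), with norm $\|u\|_{H^1}^2=\int_0^T(|u|^2+|\dot u|^2)\,dt$, and let $$\mathcal K=\{u\in H^1_T:\ u(t)\notin\Gamma\ \text{and}\ u(t+T/2)=-u(t)\ \text{for all } t\in\mathbb R\},$$ with $H^1$-closure $\overline{\mathcal K}$. Let $$\mathcal A(u)=4\int_0^T\Big(\frac{|\dot u|^2}{2}+\frac{m_0}{|u|}+\frac12\sum_{k=1}^{3}\frac{1}{|(\mathsf R^k-I)u|}\Big)dt\in[0,+\infty]$$ be the Lagrangian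 action. Then, for every $m_0\ge 0$, every minimizer $u$ of $\mathcal A$ over $\overline{\mathcal K}$ is free of total collisions: there is no $t\in\mathbb R$ at which all four satellites are at the origin, the position of the central body. -/

import Mathlib

open MeasureTheory Set
open scoped ENNReal

noncomputable section

namespace HipHop

/-- Euclidean three-space. -/
abbrev E3 : Type := EuclideanSpace ℝ (Fin 3)

/-- The generator `R` of the group `ℤ₄ = {I, R, R², R³}`: rotation by a right angle about the
vertical axis composed with the reflection in the horizontal plane. -/
def generator : Matrix (Fin 3) (Fin 3) ℝ := !![0, -1, 0; 1, 0, 0; 0, 0, -1]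

/-- `rot k x = R ^ k x`: the position of the `k`-th satellite (`k = 0, 1, 2, 3`) when the generating
particle is at `x`. -/
def rot (k : ℕ) (x : E3) : E3 := Matrix.toEuclideanLin (generator ^ k) x

/-- The collision set: points fixed by some `R ^ k` with `k = 1, 2, 3`. -/
def collisionSet : Set E3 := {x | ∃ k ∈ Finset.Icc 1 3, rot k x = x}

/-- `T`-periodic loops of class `H¹`, given by their continuous representative: periodic,
absolutely continuous on a period, with square integrable derivative. -/
def IsH1Loop (T : ℝ) (u : ℝ → E3) : Prop :=
  Function.Periodic u T ∧ AbsolutelyContinuousOnInterval u 0 T ∧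
    MemLp (deriv u) 2 (volume.restrict (Ioc 0 T))

/-- The `H¹` norm over one period. -/
def h1Norm (T : ℝ) (u : ℝ → E3) : ℝ≥0∞ :=
  (∫⁻ t in Ioc 0 T, (‖u t‖ₑ ^ 2 + ‖deriv u t‖ₑ ^ 2)) ^ (1 / 2 : ℝ)

/-- Admissible loops: `T`-periodic `H¹` loops avoiding the collision set, with the
Italian symmetry. -/
def admissible (T : ℝ) : Set (ℝ → E3) :=
  {u | IsH1Loop T u ∧ (∀ t, u t ∉ collisionSet) ∧ ∀ t, u (t + T / 2) = -u t}

/-- The closure of the set of admissible loops in the space of `T`-periodic `H¹` loops. -/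
def admissibleClosure (T : ℝ) : Set (ℝ → E3) :=
  {u | IsH1Loop T u ∧ ∀ ε : ℝ≥0∞, 0 < ε → ∃ v ∈ admissible T, h1Norm T (u - v) < ε}

/-- The Lagrangian action of the `(1+4)`-body problem, central mass `m₀`, as a function of the
motion of the generating particle. It takes values in `[0, ∞]`, with `1 / 0 = ∞`. -/
def action (m₀ T : ℝ) (u : ℝ → E3) : ℝ≥0∞ :=
  4 * ∫⁻ t in Ioc 0 T,
    (‖deriv u t‖ₑ ^ 2 / 2 + ENNReal.ofReal m₀ / ‖u t‖ₑ
      + 1 / 2 * ∑ k ∈ Finset.Icc 1 3, 1 / ‖rot k (u t) - u t‖ₑ)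

/-- A total collision: at some time all four satellites are at the position of the central
body, which is the origin. -/
def HasTotalCollision (u : ℝ → E3) : Prop := ∃ t, ∀ k ∈ Finset.range 4, rot k (u t) = 0

end HipHop

end

/-!
The proof is a level estimate: every loop in the closure with a total collision has larger action
than the circular motion in which the four satellites form a rotating square.

A total collision means `u t₀ = 0`. The Italian symmetry survives in the `H¹` closure
(`antiperiodic_of_mem_admissibleClosure`), so that `u` vanishes again at `t₀ + T / 2`, and both
halves of a period are paths from the origin to the origin. The attraction of the other satellites
is at least that of a central mass `7 / 8` (`kepler_le_potential`), so each half has at least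
the Kepler action of a collision path with central mass `c = m₀ + 7 / 8`.

The Kepler action over an interval of length `τ` is bounded below by a calibration
(`le_lintegral_kepler_of_collision`). With `ρ = |u|` and `p` affine of slope `-k`, vanishing at
the midpoint, `|u'|² / 2 + c / ρ ≥ (ρ' p - p² / 2) + c / ρ ≥ 2 s - p² / 2 + (ρ p)'` whenever
`s² ≤ c k`, and `(ρ p)'` integrates to zero because `ρ` vanishes at both ends. This gives
`2 s τ - k² τ³ / 24`. Even the best choice of `k` falls short of the sharp constant, but since there
are two collisions in each period the estimate leaves room for this loss.

The rotating square of radius `a` and angular velocity `ω = 2 π / T`, with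
`a³ ω² = M = m₀ + 1 / √2 + 1 / 4`, has action `4 T · (3 / 2) (a ω)²` (`action_circularLoop`). With
`k = (11 / 10) a ω²` and `s = (a ω)²`, admissible since `M ≤ (11 / 10) c`, collision loops have
action at least `4 T · (2 - 1.21 π² / 24) (a ω)²` (`le_action_of_collision`), which is larger
since `π² < 9.9`.
-/

namespace HipHop

/-! ### A calibration bound for Kepler collision paths -/

section Calibration

variable {E : Type*} [NormedAddCommGroup E]

lemma ofReal_integral_le_lintegral_ofReal {α : Type*} [MeasurableSpace α] {μ : Measure α}
    {f : α → ℝ} (hf : Integrable f μ) :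
    ENNReal.ofReal (∫ x, f x ∂μ) ≤ ∫⁻ x, ENNReal.ofReal (f x) ∂μ := by
  rw [integral_eq_lintegral_pos_part_sub_lintegral_neg_part hf]
  exact (ENNReal.ofReal_le_ofReal (sub_le_self _ ENNReal.toReal_nonneg)).trans
    ENNReal.ofReal_toReal_le

lemma _root_.AbsolutelyContinuousOnInterval.norm {u : ℝ → E} {a b : ℝ}
    (hu : AbsolutelyContinuousOnInterval u a b) :
    AbsolutelyContinuousOnInterval (fun t ↦ ‖u t‖) a b := by
  refine squeeze_zero (fun I ↦ Finset.sum_nonneg fun i _ ↦ dist_nonneg) (fun I ↦ ?_) hu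
  gcongr with i
  rw [Real.dist_eq, dist_eq_norm]
  exact abs_norm_sub_norm_le _ _

variable [InnerProductSpace ℝ E]

lemma abs_deriv_norm_le_norm_deriv {u : ℝ → E} {t : ℝ} (hu : DifferentiableAt ℝ u t)
    (h0 : u t ≠ 0) : |deriv (fun s ↦ ‖u s‖) t| ≤ ‖deriv u t‖ := by
  have hpos : 0 < ‖u t‖ := norm_pos_iff.2 h0
  have h1 := hu.hasDerivAt.norm_sq
  have h2 := (hu.norm ℝ h0).hasDerivAt.fun_pow 2
  have h3 := h2.unique h1
  have h4 := abs_real_inner_le_norm (u t) (deriv u t)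
  have h5 : ‖u t‖ * deriv (fun s ↦ ‖u s‖) t = inner ℝ (u t) (deriv u t) := by
    norm_num at h3
    linarith
  rw [← h5, abs_mul, abs_of_pos hpos] at h4
  exact le_of_mul_le_mul_left h4 hpos

/-- The pointwise calibration inequality. Completing the square gives
`v * p ≤ v² / 2 + p² / 2`, and the arithmetic-geometric mean inequality gives
`2 * s ≤ c / ρ + k * ρ`. -/
lemma calibration_pointwise {c k s ρ v w p : ℝ} (hc : 0 ≤ c) (hk : 0 ≤ k) (hs : s ^ 2 ≤ c * k)
    (hρ : 0 < ρ) (hv : |v| ≤ w) :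
    2 * s - p ^ 2 / 2 + (v * p - ρ * k) ≤ w ^ 2 / 2 + c / ρ := by
  have hvw : v ^ 2 ≤ w ^ 2 := sq_le_sq' (by linarith [neg_abs_le v]) ((le_abs_self v).trans hv)
  have hAM : 2 * s ≤ c / ρ + k * ρ := by
    refine abs_le_of_sq_le_sq' ?_ (by positivity) |>.2
    have : c / ρ * (k * ρ) = c * k := by field_simp
    nlinarith [sq_nonneg (c / ρ - k * ρ)]
  nlinarith [sq_nonneg (v - p)]

/-- A lower bound for the Kepler action over a time interval of length `τ` at both ends of which
the path is at the centre of attraction. It comes from the calibration `ρ * p`, where `ρ` is the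
distance to the centre and `p` is affine with slope `-k` and vanishes at the midpoint. -/
lemma le_lintegral_kepler_of_collision [FiniteDimensional ℝ E] {u : ℝ → E} {a τ c k s : ℝ}
    (hτ : 0 ≤ τ)
    (hu : AbsolutelyContinuousOnInterval u a (a + τ)) (hua : u a = 0) (hub : u (a + τ) = 0)
    (hc : 0 < c) (hk : 0 ≤ k) (hs : s ^ 2 ≤ c * k) :
    ENNReal.ofReal (2 * s * τ - k ^ 2 * τ ^ 3 / 24) ≤
      ∫⁻ t in Ioc a (a + τ), (‖deriv u t‖ₑ ^ 2 / 2 + ENNReal.ofReal c / ‖u t‖ₑ) := by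
  have hle : a ≤ a + τ := by linarith
  let p : ℝ → ℝ := fun t ↦ k * (a + τ / 2 - t)
  have hp' (t : ℝ) : HasDerivAt p (-k) t := by
    simpa using ((hasDerivAt_id t).const_sub (a + τ / 2)).const_mul k
  have hpc : Continuous p := by fun_prop
  have hpac : AbsolutelyContinuousOnInterval p a (a + τ) :=
    ContDiffOn.absolutelyContinuousOnInterval (by fun_prop)
  have hρ := hu.norm
  have hac := hρ.fun_mul hpac
  let G : ℝ → ℝ := fun t ↦ 2 * s - p t ^ 2 / 2 + deriv (fun r ↦ ‖u r‖ * p r) t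
  have hI1 : IntervalIntegrable (fun t ↦ 2 * s - p t ^ 2 / 2) volume a (a + τ) :=
    Continuous.intervalIntegrable (by fun_prop) _ _
  have hGint : IntervalIntegrable G volume a (a + τ) := hI1.add hac.intervalIntegrable_deriv
  have hG : ∫ t in a..(a + τ), G t = 2 * s * τ - k ^ 2 * τ ^ 3 / 24 := by
    have hprim : ∫ t in a..(a + τ), (2 * s - p t ^ 2 / 2) = 2 * s * τ - k ^ 2 * τ ^ 3 / 24 := by
      have hF (t : ℝ) : HasDerivAt (fun t ↦ 2 * s * t + k ^ 2 * (a + τ / 2 - t) ^ 3 / 6)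
          (2 * s - p t ^ 2 / 2) t := by
        have h1 := (hasDerivAt_id t).const_mul (2 * s)
        have h2 := ((((hasDerivAt_id t).const_sub (a + τ / 2)).fun_pow 3).const_mul
          (k ^ 2)).div_const 6
        convert! h1.add h2 using 1
        simp only [p, id]
        norm_num
        ring
      rw [intervalIntegral.integral_eq_sub_of_hasDerivAt (fun t _ ↦ hF t) hI1]
      ring
    rw [intervalIntegral.integral_add hI1 hac.intervalIntegrable_deriv, hprim,
      hac.integral_deriv_eq_sub, hua, hub]
    simp
  rw [← hG, intervalIntegral.integral_of_le hle]
  refine (ofReal_integral_le_lintegral_ofReal hGint.1).trans ?_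
  refine lintegral_mono_ae ((ae_restrict_iff' measurableSet_Ioc).2 ?_)
  filter_upwards [hu.boundedVariationOn.ae_differentiableAt_of_mem_uIcc] with t ht htmem
  have hdiff := ht (Ioc_subset_Icc_self.trans Icc_subset_uIcc htmem)
  by_cases h0 : u t = 0
  · simp [h0, ENNReal.div_zero, hc]
  have hpos : 0 < ‖u t‖ := norm_pos_iff.2 h0
  have hderiv : deriv (fun r ↦ ‖u r‖ * p r) t = deriv (fun r ↦ ‖u r‖) t * p t - ‖u t‖ * k := by
    rw [((hdiff.norm ℝ h0).hasDerivAt.fun_mul (hp' t)).deriv]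
    ring
  have hrhs : ‖deriv u t‖ₑ ^ 2 / 2 + ENNReal.ofReal c / ‖u t‖ₑ =
      ENNReal.ofReal (‖deriv u t‖ ^ 2 / 2 + c / ‖u t‖) := by
    rw [ENNReal.ofReal_add (by positivity) (by positivity), ENNReal.ofReal_div_of_pos two_pos,
      ENNReal.ofReal_div_of_pos hpos, ENNReal.ofReal_pow (norm_nonneg _), ofReal_norm, ofReal_norm]
    simp
  rw [hrhs]
  refine ENNReal.ofReal_le_ofReal ?_
  simp only [G, hderiv]
  exact calibration_pointwise hc.le hk hs hpos (abs_deriv_norm_le_norm_deriv hdiff h0)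

end Calibration

/-! ### Lower integrals of periodic functions -/

section Periodic

lemma _root_.Function.Periodic.setLIntegral_Ioc_eq {f : ℝ → ℝ≥0∞} {T : ℝ}
    (hf : Function.Periodic f T) (hT : 0 < T) (t s : ℝ) :
    ∫⁻ x in Ioc t (t + T), f x = ∫⁻ x in Ioc s (s + T), f x := by
  have : VAddInvariantMeasure (AddSubgroup.zmultiples T) ℝ volume :=
    ⟨fun c s _ => measure_preimage_add _ _ _⟩
  exact (isAddFundamentalDomain_Ioc hT t).setLIntegral_eq (isAddFundamentalDomain_Ioc hT s) _
    hf.map_vadd_zmultiples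

lemma setLIntegral_Ioc_add_right (f : ℝ → ℝ≥0∞) (a b c : ℝ) :
    ∫⁻ x in Ioc a b, f (x + c) = ∫⁻ x in Ioc (a + c) (b + c), f x := by
  have h := (measurePreserving_add_right volume c).setLIntegral_comp_preimage_emb
    (MeasurableEquiv.addRight c).measurableEmbedding f (Ioc (a + c) (b + c))
  simpa using h

/-- Over two periods, the integral of a periodic function is twice its integral over one period,
wherever that period starts. -/
lemma setLIntegral_Ioc_two_periods {f : ℝ → ℝ≥0∞} {τ : ℝ} (hf : Function.Periodic f τ)
    (hτ : 0 < τ) (a : ℝ) :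
    ∫⁻ x in Ioc 0 (τ + τ), f x = 2 * ∫⁻ x in Ioc a (a + τ), f x := by
  rw [← Ioc_union_Ioc_eq_Ioc (b := τ) hτ.le (by linarith),
    lintegral_union measurableSet_Ioc (Ioc_disjoint_Ioc_of_le le_rfl),
    hf.setLIntegral_Ioc_eq hτ τ a, two_mul]
  congr 1
  simpa using hf.setLIntegral_Ioc_eq hτ 0 a

end Periodic

/-! ### The Italian symmetry in the closure -/

section Loops

variable {T : ℝ} {u v : ℝ → E3}

lemma IsH1Loop.continuous (hT : 0 < T) (hu : IsH1Loop T u) : Continuous u := by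
  have : Fact (0 < T) := ⟨hT⟩
  have hper := hu.1
  have hc : ContinuousOn u (Icc 0 T) := by
    simpa [uIcc_of_le hT.le] using hu.2.1.continuousOn
  have h := AddCircle.liftIco_zero_continuous (p := T) (by simpa using (hper 0).symm) hc
  have heq : u = fun t : ℝ ↦ AddCircle.liftIco T 0 u (t : AddCircle T) := by
    ext1 t
    have hmod := toIcoMod_add_toIcoDiv_zsmul hT 0 t
    have hmem : toIcoMod hT 0 t ∈ Ico 0 T := by simpa using toIcoMod_mem_Ico hT 0 t
    have hcoe : ((toIcoMod hT 0 t : ℝ) : AddCircle T) = (t : AddCircle T) := by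
      rw [toIcoMod, AddCircle.coe_sub, AddCircle.coe_zsmul, AddCircle.coe_period, smul_zero,
        sub_zero]
    rw [← hcoe, AddCircle.liftIco_zero_coe_apply hmem]
    conv_lhs => rw [← hmod]
    exact hper.zsmul _ _
  rw [heq]
  exact h.comp (AddCircle.continuous_mk' T)

lemma lintegral_enorm_sq_le_h1Norm_sq (T : ℝ) (u : ℝ → E3) :
    ∫⁻ t in Ioc 0 T, ‖u t‖ₑ ^ 2 ≤ h1Norm T u ^ 2 := by
  have : h1Norm T u ^ 2 = ∫⁻ t in Ioc 0 T, (‖u t‖ₑ ^ 2 + ‖deriv u t‖ₑ ^ 2) := by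
    rw [h1Norm, ← ENNReal.rpow_natCast, ← ENNReal.rpow_mul]
    norm_num
  rw [this]
  exact lintegral_mono fun t ↦ le_self_add

/-- The Italian symmetry is a closed condition: `u (t + T / 2) + u t` has `L²` norm at most twice
that of `u - v` for each admissible `v`. -/
lemma antiperiodic_of_mem_admissibleClosure (hT : 0 < T) (hu : u ∈ admissibleClosure T) :
    Function.Antiperiodic u (T / 2) := by
  have huc := hu.1.continuous hT
  have hper : Function.Periodic u T := hu.1.1
  let w : ℝ → E3 := fun t ↦ u (t + T / 2) + u t
  have hwc : Continuous w := by fun_prop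
  have hwper : Function.Periodic w T := fun t ↦ by
    simp only [w, add_right_comm t T, hper _]
  have hbound (ε : ℝ≥0∞) (hε : 0 < ε) : ∫⁻ t in Ioc 0 T, ‖w t‖ₑ ^ 2 ≤ 4 * ε ^ 2 := by
    obtain ⟨v, hv, hvε⟩ := hu.2 ε hε
    have hvc := hv.1.continuous hT
    let d : ℝ → ℝ≥0∞ := fun t ↦ ‖(u - v) t‖ₑ ^ 2
    have hdm : Measurable d := by
      have : Continuous (u - v) := huc.sub hvc
      exact (this.measurable.enorm).pow_const 2
    have hdper : Function.Periodic d T := fun t ↦ by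
      simp only [d, Pi.sub_apply, hper t, hv.1.1 t]
    have hw (t : ℝ) : ‖w t‖ₑ ^ 2 ≤ 2 * (d (t + T / 2) + d t) := by
      have hweq : w t = (u - v) (t + T / 2) + (u - v) t := by
        simp only [w, Pi.sub_apply, hv.2.2 t]
        abel
      have hreal := add_sq_le (a := ‖(u - v) (t + T / 2)‖) (b := ‖(u - v) t‖)
      have hn : ‖w t‖ ^ 2 ≤ 2 * (‖(u - v) (t + T / 2)‖ ^ 2 + ‖(u - v) t‖ ^ 2) := by
        refine le_trans ?_ hreal
        rw [hweq]
        gcongr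
        exact norm_add_le _ _
      have := ENNReal.ofReal_le_ofReal hn
      rw [ENNReal.ofReal_mul two_pos.le, ENNReal.ofReal_add (by positivity) (by positivity)] at this
      simpa only [d, ENNReal.ofReal_pow (norm_nonneg _), ofReal_norm, ENNReal.ofReal_ofNat]
        using this
    have hshift : ∫⁻ t in Ioc 0 T, d (t + T / 2) = ∫⁻ t in Ioc 0 T, d t := by
      rw [setLIntegral_Ioc_add_right, zero_add, add_comm T]
      simpa using hdper.setLIntegral_Ioc_eq hT (T / 2) 0
    calc ∫⁻ t in Ioc 0 T, ‖w t‖ₑ ^ 2 ≤ ∫⁻ t in Ioc 0 T, 2 * (d (t + T / 2) + d t) :=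
          lintegral_mono hw
      _ = 4 * ∫⁻ t in Ioc 0 T, d t := by
          rw [lintegral_const_mul _ (by fun_prop), lintegral_add_right _ hdm, hshift]
          ring
      _ ≤ 4 * ε ^ 2 := by
          gcongr
          exact (lintegral_enorm_sq_le_h1Norm_sq T (u - v)).trans (by gcongr)
  have hzero : ∫⁻ t in Ioc 0 T, ‖w t‖ₑ ^ 2 = 0 := by
    have hlim : Filter.Tendsto (fun ε : ℝ≥0∞ ↦ 4 * ε ^ 2) (nhdsWithin 0 (Ioi 0)) (nhds 0) := by
      have hcont : Continuous fun ε : ℝ≥0∞ ↦ 4 * ε ^ 2 :=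
        (ENNReal.continuous_const_mul (by norm_num)).comp (ENNReal.continuous_pow 2)
      simpa using (hcont.tendsto 0).mono_left nhdsWithin_le_nhds
    exact nonpos_iff_eq_zero.1 (ge_of_tendsto hlim (by
      filter_upwards [self_mem_nhdsWithin] with ε hε using hbound ε hε))
  have hae : w =ᵐ[volume.restrict (Ioc 0 T)] 0 := by
    rw [lintegral_eq_zero_iff (by fun_prop)] at hzero
    filter_upwards [hzero] with t ht
    simpa using ht
  have heq : EqOn w 0 (Ioc 0 T) :=
    Measure.eqOn_Ioc_of_ae_eq volume hae hwc.continuousOn continuousOn_const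
  intro t
  obtain ⟨y, hy, hty⟩ := hwper.exists_mem_Ioc hT t 0
  exact eq_neg_of_add_eq_zero_left (hty.trans (heq (by simpa using hy)))

end Loops

/-! ### The potential -/

section Potential

lemma rot_zero (x : E3) : rot 0 x = x := by
  simp [rot]

lemma rot_neg (k : ℕ) (x : E3) : rot k (-x) = -rot k x := by
  simp [rot]

lemma rot_one (x : E3) : rot 1 x = !₂[-x 1, x 0, -x 2] := by
  ext i
  fin_cases i <;> simp [rot, generator, Matrix.toLpLin_apply, dotProduct, Fin.sum_univ_three]

lemma rot_succ (k : ℕ) (x : E3) : rot (k + 1) x = rot 1 (rot k x) := by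
  simp [rot, pow_succ', Matrix.toLpLin_apply]

lemma rot_two (x : E3) : rot 2 x = !₂[-x 0, -x 1, x 2] := by
  rw [rot_succ, rot_one, rot_one]
  simp

lemma rot_three (x : E3) : rot 3 x = !₂[x 1, -x 0, -x 2] := by
  rw [rot_succ, rot_two, rot_one]
  simp

lemma norm_sq_eq (x : E3) : ‖x‖ ^ 2 = x 0 ^ 2 + x 1 ^ 2 + x 2 ^ 2 := by
  simp [EuclideanSpace.real_norm_sq_eq, Fin.sum_univ_three]

lemma norm_rot_one_sub_sq (x : E3) :
    ‖rot 1 x - x‖ ^ 2 = 4 * ‖x‖ ^ 2 - 2 * (x 0 ^ 2 + x 1 ^ 2) := by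
  rw [norm_sq_eq, norm_sq_eq, rot_one]
  simp
  ring

lemma norm_rot_two_sub_sq (x : E3) : ‖rot 2 x - x‖ ^ 2 = 4 * (x 0 ^ 2 + x 1 ^ 2) := by
  rw [norm_sq_eq, rot_two]
  simp
  ring

lemma norm_rot_three_sub (x : E3) : ‖rot 3 x - x‖ = ‖rot 1 x - x‖ := by
  rw [← sq_eq_sq₀ (norm_nonneg _) (norm_nonneg _), norm_sq_eq, norm_sq_eq, rot_three, rot_one]
  simp
  ring

lemma norm_pos_of_rot_two_ne {x : E3} (hx : rot 2 x ≠ x) : 0 < ‖x‖ ∧ 0 < ‖rot 1 x - x‖ := by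
  have h2 : 0 < ‖rot 2 x - x‖ := norm_pos_iff.2 (sub_ne_zero.2 hx)
  have hr : 0 < x 0 ^ 2 + x 1 ^ 2 := by
    have := norm_rot_two_sub_sq x
    nlinarith
  have hx2 := norm_sq_eq x
  refine ⟨lt_of_pow_lt_pow_left₀ 2 (norm_nonneg _) (by nlinarith [sq_nonneg (x 2)]),
    lt_of_pow_lt_pow_left₀ 2 (norm_nonneg _) ?_⟩
  rw [norm_rot_one_sub_sq]
  nlinarith [sq_nonneg (x 2)]

/-- The potential energy felt by the generating particle, with values in `[0, ∞]`. -/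
noncomputable def potential (m₀ : ℝ) (x : E3) : ℝ≥0∞ :=
  ENNReal.ofReal m₀ / ‖x‖ₑ + 1 / 2 * ∑ k ∈ Finset.Icc 1 3, 1 / ‖rot k x - x‖ₑ

lemma action_eq (m₀ T : ℝ) (u : ℝ → E3) :
    action m₀ T u =
      4 * ∫⁻ t in Ioc 0 T, (‖deriv u t‖ₑ ^ 2 / 2 + potential m₀ (u t)) := by
  simp only [action, potential, add_assoc]

lemma potential_neg (m₀ : ℝ) (x : E3) : potential m₀ (-x) = potential m₀ x := by
  simp only [potential, rot_neg, enorm_neg, neg_sub_neg, enorm_sub_rev]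

lemma potential_eq_top {m₀ : ℝ} {x : E3} (hx : rot 2 x = x) : potential m₀ x = ⊤ := by
  simp [potential, Finset.sum_Icc_succ_top, hx, ENNReal.mul_top]

lemma potential_eq_ofReal {m₀ : ℝ} (hm₀ : 0 ≤ m₀) {x : E3} (hx : rot 2 x ≠ x) :
    potential m₀ x =
      ENNReal.ofReal (m₀ / ‖x‖ + (1 / ‖rot 1 x - x‖ + 1 / (2 * ‖rot 2 x - x‖))) := by
  have h2 : 0 < ‖rot 2 x - x‖ := norm_pos_iff.2 (sub_ne_zero.2 hx)
  obtain ⟨h0, h1⟩ := norm_pos_of_rot_two_ne hx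
  have hinv {y : E3} (hy : 0 < ‖y‖) : 1 / ‖y‖ₑ = ENNReal.ofReal (1 / ‖y‖) := by
    rw [ENNReal.ofReal_div_of_pos hy, ofReal_norm, ENNReal.ofReal_one]
  have hhalf : (1 / 2 : ℝ≥0∞) = ENNReal.ofReal (1 / 2) := by
    rw [ENNReal.ofReal_div_of_pos two_pos, ENNReal.ofReal_one, ENNReal.ofReal_ofNat]
  have h3 : 0 < ‖rot 3 x - x‖ := norm_rot_three_sub x ▸ h1
  have hsum : ∑ k ∈ Finset.Icc 1 3, 1 / ‖rot k x - x‖ₑ =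
      1 / ‖rot 1 x - x‖ₑ + 1 / ‖rot 2 x - x‖ₑ + 1 / ‖rot 3 x - x‖ₑ := by
    simp [Finset.sum_Icc_succ_top]
  have h3' := hinv h3
  rw [norm_rot_three_sub] at h3'
  have hcentral : ENNReal.ofReal m₀ / ‖x‖ₑ = ENNReal.ofReal (m₀ / ‖x‖) := by
    rw [ENNReal.ofReal_div_of_pos h0, ofReal_norm]
  rw [potential, hsum, hinv h1, hinv h2, h3', hhalf, hcentral]
  generalize ‖rot 1 x - x‖ = b at h1 ⊢
  generalize ‖rot 2 x - x‖ = d at h2 ⊢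
  have hb : 0 ≤ 1 / b := by positivity
  have hd : 0 ≤ 1 / d := by positivity
  rw [← ENNReal.ofReal_add hb hd, ← ENNReal.ofReal_add (add_nonneg hb hd) hb,
    ← ENNReal.ofReal_mul one_half_pos.le,
    ← ENNReal.ofReal_add (div_nonneg hm₀ h0.le) (by positivity)]
  congr 1
  ring

/-- A normalised form of the bound on the potential, with `q` the distance to the vertical axis
and `B` the distance between neighbouring satellites, both measured in units of the distance to
the origin. The inverse of `B` is bounded below by its tangent, as a function of `B ^ 2`,
at `B ^ 2 = 9 / 4`. -/
lemma seven_eighths_le {q B : ℝ} (hq : 0 < q) (hB : 0 < B) (h : B ^ 2 = 4 - 2 * q ^ 2) :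
    7 / 8 ≤ 1 / B + 1 / (4 * q) := by
  have h1 : 1 - 4 * B ^ 2 / 27 ≤ 1 / B := by
    rw [le_div_iff₀ hB]
    nlinarith [mul_nonneg (sq_nonneg (2 * B - 3)) (by linarith : (0 : ℝ) ≤ B + 3)]
  have h2 : 7 / 8 - (1 - 4 * B ^ 2 / 27) ≤ 1 / (4 * q) := by
    rw [h, le_div_iff₀ (by positivity)]
    nlinarith [mul_nonneg (sq_nonneg (q - 3 / 4)) (by linarith : (0 : ℝ) ≤ q + 3 / 2)]
  linarith

/-- The mutual attraction of the satellites is at least that of a central body of mass `7 / 8`. -/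
lemma kepler_le_potential {m₀ : ℝ} (hm₀ : 0 ≤ m₀) (x : E3) :
    ENNReal.ofReal (m₀ + 7 / 8) / ‖x‖ₑ ≤ potential m₀ x := by
  by_cases hx : rot 2 x = x
  · simp [potential_eq_top hx]
  have h2 : 0 < ‖rot 2 x - x‖ := norm_pos_iff.2 (sub_ne_zero.2 hx)
  have hr := norm_rot_two_sub_sq x
  obtain ⟨h0, h1⟩ := norm_pos_of_rot_two_ne hx
  have h := seven_eighths_le (q := ‖rot 2 x - x‖ / (2 * ‖x‖)) (B := ‖rot 1 x - x‖ / ‖x‖)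
    (by positivity) (by positivity) (by
      rw [div_pow, div_pow, hr, norm_rot_one_sub_sq]
      field_simp
      ring)
  rw [potential_eq_ofReal hm₀ hx, ← ofReal_norm, ← ENNReal.ofReal_div_of_pos h0, add_div]
  gcongr
  rw [div_le_iff₀ h0]
  refine h.trans_eq ?_
  field_simp
  ring

end Potential

/-! ### The rotating square -/

section CircularLoop

/-- The horizontal uniform circular motion with radius `a` and angular velocity `ω`. The four
satellites then form a rotating square. -/
noncomputable def circularLoop (a ω t : ℝ) : E3 :=
  (a * Real.cos (ω * t)) • EuclideanSpace.single 0 1 +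
    (a * Real.sin (ω * t)) • EuclideanSpace.single 1 1

variable {a ω T m₀ : ℝ}

@[simp] lemma circularLoop_zero (t : ℝ) : circularLoop a ω t 0 = a * Real.cos (ω * t) := by
  simp [circularLoop]

@[simp] lemma circularLoop_one (t : ℝ) : circularLoop a ω t 1 = a * Real.sin (ω * t) := by
  simp [circularLoop]

@[simp] lemma circularLoop_two (t : ℝ) : circularLoop a ω t 2 = 0 := by
  simp [circularLoop]

lemma contDiff_circularLoop (a ω : ℝ) : ContDiff ℝ 1 (circularLoop a ω) := by
  unfold circularLoop
  fun_prop

lemma circularLoop_radius_sq (t : ℝ) :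
    circularLoop a ω t 0 ^ 2 + circularLoop a ω t 1 ^ 2 = a ^ 2 := by
  rw [circularLoop_zero, circularLoop_one]
  linear_combination a ^ 2 * Real.cos_sq_add_sin_sq (ω * t)

lemma norm_circularLoop (ha : 0 < a) (t : ℝ) : ‖circularLoop a ω t‖ = a := by
  rw [← sq_eq_sq₀ (norm_nonneg _) ha.le, norm_sq_eq, circularLoop_radius_sq]
  simp

lemma norm_rot_one_circularLoop_sub (ha : 0 < a) (t : ℝ) :
    ‖rot 1 (circularLoop a ω t) - circularLoop a ω t‖ = √2 * a := by
  rw [← sq_eq_sq₀ (norm_nonneg _) (by positivity), norm_rot_one_sub_sq, circularLoop_radius_sq,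
    norm_circularLoop ha, mul_pow, Real.sq_sqrt two_pos.le]
  ring

lemma norm_rot_two_circularLoop_sub (ha : 0 < a) (t : ℝ) :
    ‖rot 2 (circularLoop a ω t) - circularLoop a ω t‖ = 2 * a := by
  rw [← sq_eq_sq₀ (norm_nonneg _) (by positivity), norm_rot_two_sub_sq, circularLoop_radius_sq]
  ring

lemma deriv_circularLoop (t : ℝ) : deriv (circularLoop a ω) t =
    (a * (-Real.sin (ω * t) * ω)) • EuclideanSpace.single 0 1 +
      (a * (Real.cos (ω * t) * ω)) • EuclideanSpace.single 1 1 := by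
  have h : HasDerivAt (fun t : ℝ ↦ ω * t) ω t := by
    simpa using (hasDerivAt_id t).const_mul ω
  exact (((h.cos.const_mul a).smul_const _).add ((h.sin.const_mul a).smul_const _)).deriv

lemma norm_deriv_circularLoop (ha : 0 < a) (hω : 0 < ω) (t : ℝ) :
    ‖deriv (circularLoop a ω) t‖ = a * ω := by
  rw [← sq_eq_sq₀ (norm_nonneg _) (by positivity), norm_sq_eq, deriv_circularLoop]
  simp
  linear_combination a ^ 2 * ω ^ 2 * Real.sin_sq_add_cos_sq (ω * t)

lemma circularLoop_antiperiodic (hω : ω * T = 2 * Real.pi) (t : ℝ) :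
    circularLoop a ω (t + T / 2) = -circularLoop a ω t := by
  have : ω * (t + T / 2) = ω * t + Real.pi := by linear_combination hω / 2
  simp only [circularLoop, this, Real.cos_add_pi, Real.sin_add_pi]
  module

lemma circularLoop_mem_admissible (ha : 0 < a) (hω : 0 < ω) (hωT : ω * T = 2 * Real.pi) :
    circularLoop a ω ∈ admissible T := by
  have hanti := circularLoop_antiperiodic (a := a) hωT
  refine ⟨⟨fun t ↦ ?_, (contDiff_circularLoop a ω).contDiffOn.absolutelyContinuousOnInterval, ?_⟩,
    fun t ↦ ?_, hanti⟩
  · rw [← add_halves T, ← add_assoc, hanti, hanti, neg_neg]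
  · exact MemLp.of_bound ((contDiff_circularLoop a ω).continuous_deriv le_rfl).aestronglyMeasurable
      (a * ω) (.of_forall fun t ↦ (norm_deriv_circularLoop ha hω t).le)
  · rintro ⟨k, hk, hfix⟩
    have h1 := norm_rot_one_circularLoop_sub (ω := ω) ha t
    have h2 := norm_rot_two_circularLoop_sub (ω := ω) ha t
    have h3 := norm_rot_three_sub (circularLoop a ω t)
    have hpos : 0 < √2 * a := by positivity
    rw [Finset.mem_Icc] at hk
    obtain ⟨hk1, hk3⟩ := hk
    have hzero : ‖rot k (circularLoop a ω t) - circularLoop a ω t‖ = 0 := by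
      rw [hfix, sub_self, norm_zero]
    interval_cases k <;> linarith

lemma admissible_subset_admissibleClosure : admissible T ⊆ admissibleClosure T := by
  refine fun v hv ↦ ⟨hv.1, fun ε hε ↦ ⟨v, hv, ?_⟩⟩
  have : deriv (v - v) = 0 := by
    rw [sub_self]
    exact deriv_const' 0
  simpa [h1Norm, this] using hε

lemma action_circularLoop (hm₀ : 0 ≤ m₀) (ha : 0 < a) (hω : 0 < ω) :
    action m₀ T (circularLoop a ω) =
      ENNReal.ofReal (4 * T * ((a * ω) ^ 2 / 2 + (m₀ + 1 / √2 + 1 / 4) / a)) := by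
  have hrot (t : ℝ) : rot 2 (circularLoop a ω t) ≠ circularLoop a ω t := by
    intro h
    have := norm_rot_two_circularLoop_sub (ω := ω) ha t
    rw [h, sub_self, norm_zero] at this
    linarith
  have hint (t : ℝ) : ‖deriv (circularLoop a ω) t‖ₑ ^ 2 / 2 + potential m₀ (circularLoop a ω t) =
      ENNReal.ofReal ((a * ω) ^ 2 / 2 + (m₀ + 1 / √2 + 1 / 4) / a) := by
    rw [potential_eq_ofReal hm₀ (hrot t), norm_circularLoop ha, norm_rot_one_circularLoop_sub ha,
      norm_rot_two_circularLoop_sub ha, ← ofReal_norm, norm_deriv_circularLoop ha hω,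
      ← ENNReal.ofReal_pow (by positivity), ← ENNReal.ofReal_ofNat 2,
      ← ENNReal.ofReal_div_of_pos two_pos, ← ENNReal.ofReal_add (by positivity) (by positivity)]
    congr 1
    field_simp
    ring
  rw [action_eq]
  simp_rw [hint]
  rw [setLIntegral_const, Real.volume_Ioc, sub_zero, ← ENNReal.ofReal_ofNat 4,
    ← ENNReal.ofReal_mul (by positivity), ← ENNReal.ofReal_mul (by positivity)]
  congr 1
  ring

end CircularLoop

/-! ### The level of collision loops -/

section Collision

variable {T m₀ : ℝ} {u : ℝ → E3}

/-- A level estimate for collision loops: by the Italian symmetry a total collision recurs after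
half a period, so that the Kepler bound applies to both halves of a period. -/
lemma le_action_of_collision {k s t₀ : ℝ} (hT : 0 < T) (hm₀ : 0 ≤ m₀)
    (hu : u ∈ admissibleClosure T) (ht₀ : u t₀ = 0) (hk : 0 ≤ k)
    (hs : s ^ 2 ≤ (m₀ + 7 / 8) * k) :
    ENNReal.ofReal (8 * (s * T - k ^ 2 * T ^ 3 / 192)) ≤ action m₀ T u := by
  have hτ : 0 < T / 2 := half_pos hT
  have hanti := antiperiodic_of_mem_admissibleClosure hT hu
  have hnorm : Function.Periodic (fun t ↦ ‖u t‖) (T / 2) := fun t ↦ by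
    simp only [hanti t, norm_neg]
  -- Half a period starting in `[0, T / 2)` stays in `[0, T]`, where `u` is absolutely continuous.
  obtain ⟨a, ha, hua⟩ := hnorm.exists_mem_Ico₀ hτ t₀
  have hua0 : u a = 0 := by simpa [ht₀] using hua.symm
  have hub0 : u (a + T / 2) = 0 := by rw [hanti, hua0, neg_zero]
  have hac : AbsolutelyContinuousOnInterval u a (a + T / 2) := by
    refine hu.1.2.1.mono ?_
    rw [uIcc_of_le hT.le, uIcc_of_le (by linarith)]
    exact Icc_subset_Icc ha.1 (by linarith [ha.2])
  have hderiv (t : ℝ) : deriv u (t + T / 2) = -deriv u t := by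
    rw [← deriv_comp_add_const, hanti.funext, deriv.neg]
  have hper : Function.Periodic (fun t ↦ ‖deriv u t‖ₑ ^ 2 / 2 + potential m₀ (u t)) (T / 2) :=
    fun t ↦ by simp only [hderiv, hanti t, potential_neg, enorm_neg]
  have hkepler := le_lintegral_kepler_of_collision hτ.le hac hua0 hub0
    (by linarith : 0 < m₀ + 7 / 8) hk hs
  have htwo := setLIntegral_Ioc_two_periods hper hτ a
  rw [add_halves] at htwo
  rw [action_eq, htwo]
  calc ENNReal.ofReal (8 * (s * T - k ^ 2 * T ^ 3 / 192))
      = 4 * (2 * ENNReal.ofReal (2 * s * (T / 2) - k ^ 2 * (T / 2) ^ 3 / 24)) := by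
        rw [← ENNReal.ofReal_ofNat 4, ← ENNReal.ofReal_ofNat 2, ← ENNReal.ofReal_mul (by positivity),
          ← ENNReal.ofReal_mul (by positivity)]
        congr 1
        ring
    _ ≤ _ := by
        gcongr
        refine hkepler.trans (lintegral_mono fun t ↦ ?_)
        gcongr
        exact kepler_le_potential hm₀ _

end Collision

end HipHop

/-- Minimizers of the action in the `H¹` closure of the set of admissible loops are free of total
collisions, for every central mass `m₀ ≥ 0`. -/
theorem mainTheorem6 (T : ℝ) (hT : 0 < T) (m₀ : ℝ) (hm₀ : 0 ≤ m₀) (u : ℝ → HipHop.E3)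
    (hu : u ∈ HipHop.admissibleClosure T)
    (hmin : IsMinOn (HipHop.action m₀ T) (HipHop.admissibleClosure T) u) :
    ¬ HipHop.HasTotalCollision u := by
  rintro ⟨t₀, ht₀⟩
  have hut₀ : u t₀ = 0 := by
    simpa [HipHop.rot_zero] using ht₀ 0 (by simp)
  -- The circular loop is compared at the radius `a` of the relative equilibrium, `a³ ω² = M`.
  set M : ℝ := m₀ + 1 / √2 + 1 / 4 with hM
  set ω : ℝ := 2 * Real.pi / T with hω
  have hωpos : 0 < ω := by positivity
  have hωT : ω * T = 2 * Real.pi := by rw [hω]; field_simp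
  obtain ⟨a, ha, ha3⟩ : ∃ a : ℝ, 0 < a ∧ a ^ 3 * ω ^ 2 = M := by
    refine ⟨(M / ω ^ 2) ^ (1 / 3 : ℝ), by positivity, ?_⟩
    rw [← Real.rpow_natCast, ← Real.rpow_mul (by positivity)]
    norm_num
    field_simp
  have hM_le : M ≤ 11 / 10 * (m₀ + 7 / 8) := by
    have hsqrt : 1 / √2 ≤ 71 / 100 := by
      rw [div_le_iff₀ (by positivity)]
      nlinarith [Real.sq_sqrt (zero_le_two (α := ℝ)), Real.sqrt_nonneg 2]
    linarith
  -- In units of `a` and `ω`, the calibration has slope `11 / 10`, close to the best one.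
  have hlow := HipHop.le_action_of_collision (k := 11 / 10 * (a * ω ^ 2)) (s := (a * ω) ^ 2)
    hT hm₀ hu hut₀ (by positivity) (by
      calc ((a * ω) ^ 2) ^ 2 = M * (a * ω ^ 2) := by rw [← ha3]; ring
        _ ≤ 11 / 10 * (m₀ + 7 / 8) * (a * ω ^ 2) := by gcongr
        _ = _ := by ring)
  have hupp : HipHop.action m₀ T u ≤ HipHop.action m₀ T (HipHop.circularLoop a ω) :=
    hmin (HipHop.admissible_subset_admissibleClosure
      (HipHop.circularLoop_mem_admissible ha hωpos hωT))
  rw [HipHop.action_circularLoop hm₀ ha hωpos, ← hM] at hupp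
  have hle := (ENNReal.ofReal_le_ofReal_iff (by positivity)).1 (hlow.trans hupp)
  have hMa : M / a = (a * ω) ^ 2 := by
    rw [← ha3]
    field_simp
  have hk : (11 / 10 * (a * ω ^ 2)) ^ 2 * T ^ 3 =
      121 / 25 * Real.pi ^ 2 * ((a * ω) ^ 2 * T) := by
    linear_combination 121 / 100 * (a * ω) ^ 2 * T * (ω * T + 2 * Real.pi) * hωT
  rw [hMa, hk] at hle
  have hX : 0 < (a * ω) ^ 2 * T := by positivity
  have hpi : Real.pi ^ 2 < 9.9 := by nlinarith [Real.pi_lt_d4, Real.pi_pos]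
  nlinarith
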